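/- All Hilbert spaces are finite dimensional, all logarithms are to base $2$, and $\|A\|_1=\operatorname{Tr}\sqrt{A^\dagger A}$. A state is a positive semidefinite operator of trace one. For states let $F(\rho,\sigma)=\|\sqrt\rho\sqrt\sigma\|_1$, let $P(\rho,\sigma)=\sqrt{1-F(\rho,\sigma)^2}$ be the purified distance, and let $B^{\epsilon}(\rho)$ be the set of states $\rho'$ with $P(\rho',\rho)\le\epsilon$. Put $$D_{\max}(\rho\|\sigma)=\inf\{\lambda\in\mathbb R:\rho\le 2^{\lambda}\sigma\},\qquad D_{\max}^{\epsilon}(\rho\|\sigma)=\inf_{\rho'\in B^{\epsilon}(\rho)}D_{\max}(\rho'\|\sigma),\qquad I_{\max}^{\epsilon}(A:B)_\rho=D_{\max}^{\epsilon}(\rho^{AB}\|\rho^A\otimes\rho^B),$$ where $\inf\emptyset=+\infty$. **Lemma (successive cancellation smoothed distributed covering lemma).** There is a universal constant $c$ (the $O(1)$ term below) such that the following holds. Let $P_X$ and $P_Y$ be probability distributions on finite alphabets $\mathcal X$ and $\mathcal Y$, let $\rho^{CE}_{x,y}$ be a state on $C\otimes E$ for all $x\in\mathcal X$, $y\in\mathcal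 Y$, and let $$\rho^{XYCE}=\sum_{x\in\mathcal X,\,y\in\mathcal Y}P_X(x)P_Y(y)\,|x\rangle\langle x|^X\otimes|y\rangle\langle y|^Y\otimes\rho^{CE}_{x,y}$$ be the control state; write $\rho^E_{x,y}=\operatorname{Tr}_C\rho^{CE}_{x,y}$ and $\rho^E=\operatorname{Tr}_{XYC}\rho^{XYCE}$. Let $\delta>0$ and $0<\epsilon'<\delta$, and let $K_1,K_2\ge1$ be integers with $$\log K_1\ \ge\ I_{\max}^{\delta-\epsilon'}(X:E)_\rho+\log\frac{3}{\epsilon'^3}-\frac14\log\delta,$$ $$\log K_2\ \ge\ I_{\max}^{\delta-\epsilon'}(Y:EX)_\rho+\log\frac{3}{\epsilon'^3}-\frac14\log\delta+c.$$ If $x_1,\dots,x_{K_1}\sim P_X$ and $y_1,\dots,y_{K_2}\sim P_Y$ are all drawn independently, then $$\mathbb E_{\substack{x_1,\dots,x_{K_1}\\ y_1,\dots,y_{K_2}}}\left\|\frac1{K_1K_2}\sum_{i=1}^{K_1}\sum_{j=1}^{K_2}\rho^E_{x_i,y_j}-\rho^E\right\|_1\ \le\ 20\,\delta^{1/8}.$$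 -/

import Mathlib

open scoped Matrix Kronecker ComplexOrder MatrixOrder

noncomputable section

namespace CQMAC

/-- A quantum state on the finite-dimensional Hilbert space with orthonormal basis indexed by `S`:
a positive semidefinite matrix of trace one. -/
def IsState {S : Type*} [Fintype S] (ρ : Matrix S S ℂ) : Prop :=
  ρ.PosSemidef ∧ ρ.trace = 1

/-- The (unnormalised) trace norm `‖A‖₁ = Tr √(A† A)`. -/
def traceNorm {S : Type*} [Fintype S] [DecidableEq S] (A : Matrix S S ℂ) : ℝ :=
  (CFC.sqrt (Aᴴ * A)).trace.re

/-- The fidelity `F(ρ, σ) = ‖√ρ √σ‖₁`. -/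
def fidelity {S : Type*} [Fintype S] [DecidableEq S] (ρ σ : Matrix S S ℂ) : ℝ :=
  traceNorm (CFC.sqrt ρ * CFC.sqrt σ)

/-- The purified distance `P(ρ, σ) = √(1 - F(ρ, σ)²)`. -/
def purifiedDistance {S : Type*} [Fintype S] [DecidableEq S] (ρ σ : Matrix S S ℂ) : ℝ :=
  Real.sqrt (1 - fidelity ρ σ ^ 2)

/-- The set of states at purified distance at most `ε` from `ρ`. -/
def purifiedBall {S : Type*} [Fintype S] [DecidableEq S] (ε : ℝ) (ρ : Matrix S S ℂ) :
    Set (Matrix S S ℂ) :=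
  {ρ' | IsState ρ' ∧ purifiedDistance ρ' ρ ≤ ε}

/-- The max relative entropy `inf {l : ℝ | ρ ≤ 2 ^ l σ}` in the Loewner order, as an extended real
number: it is `⊤` when there is no such `l`. -/
def maxRelEntropy {S : Type*} [Fintype S] (ρ σ : Matrix S S ℂ) : EReal :=
  ⨅ (l : ℝ) (_ : (((2 : ℝ) ^ l) • σ - ρ).PosSemidef), (l : EReal)

/-- The smooth max relative entropy: the infimum of `maxRelEntropy ρ' σ` over the `ε`-ball of `ρ`. -/
def smoothMaxRelEntropy {S : Type*} [Fintype S] [DecidableEq S] (ε : ℝ) (ρ σ : Matrix S S ℂ) :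
    EReal :=
  ⨅ ρ' ∈ purifiedBall ε ρ, maxRelEntropy ρ' σ

/-- The marginal on the first system of a bipartite matrix. -/
def marginalFst {A B : Type*} [Fintype B] (ρ : Matrix (A × B) (A × B) ℂ) : Matrix A A ℂ :=
  fun a a' => ∑ b, ρ (a, b) (a', b)

/-- The marginal on the second system of a bipartite matrix. -/
def marginalSnd {A B : Type*} [Fintype A] (ρ : Matrix (A × B) (A × B) ℂ) : Matrix B B ℂ :=
  fun b b' => ∑ a, ρ (a, b) (a, b')

/-- The smooth max mutual information `I_max^ε(A:B)_ρ = D_max^ε(ρ^{AB} ‖ ρ^A ⊗ ρ^B)`. -/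
def smoothMaxInfo {A B : Type*} [Fintype A] [DecidableEq A] [Fintype B] [DecidableEq B]
    (ε : ℝ) (ρ : Matrix (A × B) (A × B) ℂ) : EReal :=
  smoothMaxRelEntropy ε ρ (marginalFst ρ ⊗ₖ marginalSnd ρ)

section ControlState

variable {X Y C E : Type*}

/-- The control state `∑ x y, P_X(x) P_Y(y) |x⟩⟨x| ⊗ |y⟩⟨y| ⊗ ρ^{CE}_{x,y}`. -/
def controlState [Fintype X] [DecidableEq X] [Fintype Y] [DecidableEq Y]
    (PX : X → ℝ) (PY : Y → ℝ) (ρ : X → Y → Matrix (C × E) (C × E) ℂ) :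
    Matrix (X × Y × C × E) (X × Y × C × E) ℂ :=
  ∑ x, ∑ y, (PX x * PY y) •
    (Matrix.single x x (1 : ℂ) ⊗ₖ (Matrix.single y y (1 : ℂ) ⊗ₖ ρ x y))

/-- The marginal on the systems `X` and `E` of a matrix on `X`, `Y`, `C`, `E`. -/
def marginalXE [Fintype Y] [Fintype C] (ρ : Matrix (X × Y × C × E) (X × Y × C × E) ℂ) :
    Matrix (X × E) (X × E) ℂ :=
  fun s t => ∑ y, ∑ c, ρ (s.1, y, c, s.2) (t.1, y, c, t.2)

/-- The marginal on the systems `Y` and `EX` of a matrix on `X`, `Y`, `C`, `E`. -/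
def marginalYEX [Fintype C] (ρ : Matrix (X × Y × C × E) (X × Y × C × E) ℂ) :
    Matrix (Y × (E × X)) (Y × (E × X)) ℂ :=
  fun s t => ∑ c, ρ (s.2.2, s.1, c, s.2.1) (t.2.2, t.1, c, t.2.1)

/-- The marginal on the system `E` of a matrix on `X`, `Y`, `C`, `E`. -/
def marginalE [Fintype X] [Fintype Y] [Fintype C]
    (ρ : Matrix (X × Y × C × E) (X × Y × C × E) ℂ) : Matrix E E ℂ :=
  fun e e' => ∑ x, ∑ y, ∑ c, ρ (x, y, c, e) (x, y, c, e')

end ControlState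

end CQMAC

end

namespace CQMAC

open Matrix

/-! ### Trace norm: variational formula, Cauchy–Schwarz, pinching, fidelity. -/

section TraceNorm

/-! Sampling is cancelled one index at a time. Replacing each `ρ_{x,y}` by its average over `y`
splits the joint error into the error of sampling `y` for a typical fixed `x`, plus that of sampling
`x` for the averaged states (`sum_traceNorm_joint_le`).

Each error is a variance estimate. If `s z ≤ l • τ` for all `z`, rescale by an invertible root `R`
of a slight enlargement of `τ`. Cauchy–Schwarz bounds the trace norm of the deviation by
Hilbert–Schmidt quantities; independence removes the cross terms, and `s z ≤ l • R²` bounds the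
remaining variance by `l / K` times the mean trace (`covering_of_dominated`).

Smoothing supplies the domination: a state near the marginal and below `2 ^ l` times the product of
its marginals is cut into its diagonal blocks along the classical registers. Pinching keeps the
blocks close on average (`exists_dominated_ensemble`), and `covering_of_approx` pays for that
distance. Each of the two errors is at most `8 * δ` when `δ ≤ 1`; for `δ > 1` the trivial bound 2
suffices. -/

theorem re_trace_nonneg {S : Type*} [Fintype S] {A : Matrix S S ℂ} (hA : A.PosSemidef) :
    0 ≤ A.trace.re :=
  (Complex.le_def.1 hA.trace_nonneg).1

variable {S : Type*} [Fintype S] [DecidableEq S]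

/-- Polar decomposition of a square matrix, with a unitary phase. -/
theorem exists_unitary_mul_eq_sqrt (A : Matrix S S ℂ) :
    ∃ U ∈ unitaryGroup S ℂ, U * A = CFC.sqrt (Aᴴ * A) := by
  have hP : (Aᴴ * A).PosSemidef := posSemidef_conjTranspose_mul_self A
  obtain ⟨V, hV⟩ : ∃ V, V = hP.1.eigenvectorUnitary := ⟨_, rfl⟩
  obtain ⟨l, hl⟩ : ∃ l, l = hP.1.eigenvalues := ⟨_, rfl⟩
  have hl0 : ∀ i, 0 ≤ l i := fun i => hl ▸ hP.eigenvalues_nonneg i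
  have hVs : star (V : Matrix S S ℂ) * V = 1 := Unitary.coe_star_mul_self V
  have hVs' : (V : Matrix S S ℂ) * star (V : Matrix S S ℂ) = 1 := Unitary.coe_mul_star_self V
  have hspec : Aᴴ * A = V * diagonal (fun i => (l i : ℂ)) * star (V : Matrix S S ℂ) := by
    have := hP.1.spectral_theorem
    rw [Unitary.conjStarAlgAut_apply, ← hl, ← hV] at this
    exact this
  -- The columns of `A V` are orthogonal with squared norms `l i`. Normalising the nonzero ones and
  -- completing them to an orthonormal basis gives a genuine unitary even when `A` is singular.
  obtain ⟨G, hG⟩ : ∃ G, G = A * (V : Matrix S S ℂ) := ⟨_, rfl⟩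
  have hA : A = G * star (V : Matrix S S ℂ) := by rw [hG, mul_assoc, hVs', mul_one]
  have hGG : Gᴴ * G = diagonal (fun i => (l i : ℂ)) := by
    rw [hG, conjTranspose_mul, mul_assoc, ← mul_assoc Aᴴ, hspec, ← star_eq_conjTranspose]
    simp only [← mul_assoc, hVs, one_mul]
    rw [mul_assoc, hVs, mul_one]
  have hentry : ∀ i j, ∑ k, star (G k i) * G k j = if i = j then (l i : ℂ) else 0 := by
    intro i j
    have := congrFun (congrFun hGG i) j
    rwa [diagonal_apply, mul_apply] at this
  obtain ⟨w, hw⟩ : ∃ w : S → EuclideanSpace ℂ S,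
      w = fun i => WithLp.toLp 2 (fun k => (((√(l i))⁻¹ : ℝ) : ℂ) * G k i) := ⟨_, rfl⟩
  have horth : Orthonormal ℂ (({i | l i ≠ 0} : Set S).domRestrict w) := by
    rw [orthonormal_iff_ite]
    rintro ⟨i, hi⟩ ⟨j, hj⟩
    have h1 : inner ℂ (w i) (w j)
        = (((√(l i))⁻¹ * (√(l j))⁻¹ : ℝ) : ℂ) * ∑ k, star (G k i) * G k j := by
      rw [hw, PiLp.inner_apply, Finset.mul_sum]
      refine Finset.sum_congr rfl fun k _ => ?_
      simp [RCLike.inner_apply]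
      ring
    simp only [Set.domRestrict_apply, Subtype.mk.injEq]
    rw [h1, hentry]
    split_ifs with h
    · subst h
      rw [← Complex.ofReal_mul, ← mul_inv, Real.mul_self_sqrt (hl0 i), inv_mul_cancel₀ hi,
        Complex.ofReal_one]
    · rw [mul_zero]
  obtain ⟨b, hb⟩ := horth.exists_orthonormalBasis_extension_of_card_eq (by simp)
  obtain ⟨W, hW⟩ : ∃ W, W = (EuclideanSpace.basisFun S ℂ).toBasis.toMatrix b.toBasis := ⟨_, rfl⟩
  have hWu : W ∈ unitaryGroup S ℂ :=
    hW ▸ (EuclideanSpace.basisFun S ℂ).toMatrix_orthonormalBasis_mem_unitary b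
  have hWe : ∀ k i, W k i = b i k := by
    intro k i
    rw [hW]
    simp [Module.Basis.toMatrix_apply]
  have hGW : G = W * diagonal (fun i => ((√(l i) : ℝ) : ℂ)) := by
    ext k i
    rw [mul_diagonal, hWe]
    by_cases hi : l i = 0
    · have h0 : ∑ k, star (G k i) * G k i = 0 := by simpa [hi] using hentry i i
      have := (Finset.sum_eq_zero_iff_of_nonneg
        (fun k _ => star_mul_self_nonneg (G k i))).1 h0 k (Finset.mem_univ k)
      have hz : G k i = 0 := by simpa using this
      simp [hi, hz]
    · rw [hb i hi, hw]
      have : ((√(l i) : ℝ) : ℂ) ≠ 0 := by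
        exact_mod_cast (Real.sqrt_pos.2 (lt_of_le_of_ne (hl0 i) (Ne.symm hi))).ne'
      simp only [Complex.ofReal_inv]
      field_simp
  have hWs : star W * W = 1 := mem_unitaryGroup_iff'.1 hWu
  refine ⟨V * star W, mul_mem V.2 (Unitary.star_mem hWu), ?_⟩
  have hUA : V * star W * A
      = V * diagonal (fun i => ((√(l i) : ℝ) : ℂ)) * star (V : Matrix S S ℂ) := by
    rw [hA, hGW]
    simp only [← mul_assoc]
    rw [mul_assoc (V : Matrix S S ℂ), hWs, mul_one]
  rw [hUA]
  symm
  apply CFC.sqrt_unique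
  · rw [hspec]
    simp only [← mul_assoc]
    rw [mul_assoc _ (star (V : Matrix S S ℂ)) (V : Matrix S S ℂ), hVs, mul_one,
      mul_assoc (V : Matrix S S ℂ), diagonal_mul_diagonal]
    congr 4
    ext i
    rw [← Complex.ofReal_mul, Real.mul_self_sqrt (hl0 i)]
  · rw [nonneg_iff_posSemidef]
    refine PosSemidef.mul_mul_conjTranspose_same (PosSemidef.diagonal fun i => ?_) _
    simp

theorem exists_unitary_traceNorm_eq (A : Matrix S S ℂ) :
    ∃ U ∈ unitaryGroup S ℂ, traceNorm A = (U * A).trace.re := by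
  obtain ⟨U, hU, h⟩ := exists_unitary_mul_eq_sqrt A
  exact ⟨U, hU, by rw [h, traceNorm]⟩

/-- Cauchy–Schwarz for the Hilbert–Schmidt inner product, combined with the AM-GM inequality. -/
theorem re_trace_conjTranspose_mul_le (X Y : Matrix S S ℂ) {c : ℝ} (hc : 0 < c) :
    (Xᴴ * Y).trace.re ≤ (c * (Xᴴ * X).trace.re + c⁻¹ * (Yᴴ * Y).trace.re) / 2 := by
  have h := re_trace_nonneg (posSemidef_conjTranspose_mul_self (c • X - Y))
  have h1 : (Yᴴ * X).trace.re = (Xᴴ * Y).trace.re := by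
    rw [← conjTranspose_conjTranspose X, ← conjTranspose_mul, trace_conjTranspose]
    simp
  simp only [conjTranspose_sub, conjTranspose_smul, star_trivial, sub_mul, mul_sub, trace_sub,
    Complex.sub_re, smul_mul_assoc, mul_smul_comm, trace_smul, Complex.real_smul,
    Complex.re_ofReal_mul, h1] at h
  have h2 : 0 ≤ c⁻¹ * (c * (c * (Xᴴ * X).trace.re) - c * (Xᴴ * Y).trace.re
      - (c * (Xᴴ * Y).trace.re - (Yᴴ * Y).trace.re)) := mul_nonneg (by positivity) (by linarith)
  have h3 : c⁻¹ * c = 1 := inv_mul_cancel₀ hc.ne'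
  linear_combination h2 / 2 - ((Xᴴ * Y).trace.re - c * (Xᴴ * X).trace.re / 2) * h3

/-- The unitary attaining the norm is absorbed into `X` without changing `Tr Xᴴ X`. Keeping `c` free
avoids square roots: the bound is linear in the second moments, so expectations can be taken without
Jensen. -/
theorem traceNorm_conjTranspose_mul_le (X Y : Matrix S S ℂ) {c : ℝ} (hc : 0 < c) :
    traceNorm (Xᴴ * Y) ≤ (c * (Xᴴ * X).trace.re + c⁻¹ * (Yᴴ * Y).trace.re) / 2 := by
  obtain ⟨U, hU, h⟩ := exists_unitary_traceNorm_eq (Xᴴ * Y)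
  have h1 := re_trace_conjTranspose_mul_le (X * Uᴴ) Y hc
  have h2 : Uᴴ * U = 1 := mem_unitaryGroup_iff'.1 hU
  rw [h, ← mul_assoc]
  rw [conjTranspose_mul, conjTranspose_conjTranspose, ← mul_assoc,
    trace_mul_comm (U * Xᴴ * X) Uᴴ, ← mul_assoc, ← mul_assoc, h2, one_mul] at h1
  exact h1

/-- With `A = Vᴴ H` and `H = R²`, Cauchy–Schwarz applies to two factors that both have squared norm
`Tr H`. Together with attainment this makes the trace norm a maximum over unitaries, which yields
the norm properties below. -/
theorem re_trace_unitary_mul_le {U : Matrix S S ℂ} (hU : U ∈ unitaryGroup S ℂ)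
    (A : Matrix S S ℂ) : (U * A).trace.re ≤ traceNorm A := by
  obtain ⟨V, hV, hVA⟩ := exists_unitary_mul_eq_sqrt A
  have hV1 : Vᴴ * V = 1 := mem_unitaryGroup_iff'.1 hV
  have hV2 : V * Vᴴ = 1 := mem_unitaryGroup_iff.1 hV
  have hU1 : Uᴴ * U = 1 := mem_unitaryGroup_iff'.1 hU
  have hU2 : U * Uᴴ = 1 := mem_unitaryGroup_iff.1 hU
  obtain ⟨H, hH⟩ : ∃ H, H = CFC.sqrt (Aᴴ * A) := ⟨_, rfl⟩
  have hH0 : 0 ≤ H := hH ▸ CFC.sqrt_nonneg _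
  obtain ⟨R, hR⟩ : ∃ R, R = CFC.sqrt H := ⟨_, rfl⟩
  have hRR : R * R = H := hR ▸ CFC.sqrt_mul_sqrt_self H
  have hRh : Rᴴ = R := (nonneg_iff_posSemidef.1 (hR ▸ CFC.sqrt_nonneg H)).1
  have hA : A = Vᴴ * H := by rw [hH, ← hVA, ← mul_assoc, hV1, one_mul]
  have key := re_trace_conjTranspose_mul_le ((U * Vᴴ)ᴴ * R) R one_pos
  have e1 : (((U * Vᴴ)ᴴ * R)ᴴ * R).trace = (U * A).trace := by
    rw [conjTranspose_mul, conjTranspose_conjTranspose, hRh, mul_assoc, trace_mul_comm, mul_assoc,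
      hRR, mul_assoc, ← hA]
  have e2 : (((U * Vᴴ)ᴴ * R)ᴴ * ((U * Vᴴ)ᴴ * R)) = H := by
    simp only [conjTranspose_mul, conjTranspose_conjTranspose, hRh]
    rw [← hRR]
    simp only [mul_assoc]
    rw [← mul_assoc Vᴴ V, hV1, one_mul, ← mul_assoc U, hU2, one_mul]
  rw [e1, e2, hRh, hRR] at key
  rw [traceNorm, ← hH]
  linarith

theorem traceNorm_nonneg (A : Matrix S S ℂ) : 0 ≤ traceNorm A :=
  re_trace_nonneg (nonneg_iff_posSemidef.1 (CFC.sqrt_nonneg _))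

theorem traceNorm_add_le (A B : Matrix S S ℂ) :
    traceNorm (A + B) ≤ traceNorm A + traceNorm B := by
  obtain ⟨U, hU, h⟩ := exists_unitary_traceNorm_eq (A + B)
  rw [h, mul_add, trace_add, Complex.add_re]
  exact add_le_add (re_trace_unitary_mul_le hU A) (re_trace_unitary_mul_le hU B)

theorem traceNorm_neg (A : Matrix S S ℂ) : traceNorm (-A) = traceNorm A := by
  simp [traceNorm]

theorem traceNorm_sub_comm (A B : Matrix S S ℂ) : traceNorm (A - B) = traceNorm (B - A) := by
  rw [← traceNorm_neg, neg_sub]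

theorem traceNorm_sub_le (A B : Matrix S S ℂ) :
    traceNorm (A - B) ≤ traceNorm A + traceNorm B := by
  rw [sub_eq_add_neg, ← traceNorm_neg B]
  exact traceNorm_add_le A (-B)

theorem traceNorm_zero : traceNorm (0 : Matrix S S ℂ) = 0 := by
  simp [traceNorm]

theorem traceNorm_sum_le {ι : Type*} (s : Finset ι) (f : ι → Matrix S S ℂ) :
    traceNorm (∑ i ∈ s, f i) ≤ ∑ i ∈ s, traceNorm (f i) :=
  Finset.le_sum_of_subadditive _ traceNorm_zero.le traceNorm_add_le s f

theorem traceNorm_smul {c : ℝ} (hc : 0 ≤ c) (A : Matrix S S ℂ) :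
    traceNorm (c • A) = c * traceNorm A := by
  apply le_antisymm
  · obtain ⟨U, hU, h⟩ := exists_unitary_traceNorm_eq (c • A)
    rw [h, mul_smul_comm, trace_smul, Complex.real_smul, Complex.re_ofReal_mul]
    exact mul_le_mul_of_nonneg_left (re_trace_unitary_mul_le hU A) hc
  · obtain ⟨U, hU, h⟩ := exists_unitary_traceNorm_eq A
    have := re_trace_unitary_mul_le hU (c • A)
    rwa [mul_smul_comm, trace_smul, Complex.real_smul, Complex.re_ofReal_mul, ← h] at this

theorem traceNorm_of_posSemidef {A : Matrix S S ℂ} (hA : A.PosSemidef) :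
    traceNorm A = A.trace.re := by
  rw [traceNorm, hA.1, CFC.sqrt_mul_self A (nonneg_iff_posSemidef.2 hA)]

/-- Pinching to the diagonal blocks does not increase the trace norm. -/
theorem sum_traceNorm_block_le {I Z : Type*} [Fintype I] [DecidableEq I] [Fintype Z]
    [DecidableEq Z] (g : S × Z ≃ I) (M : Matrix I I ℂ) :
    ∑ z, traceNorm (M.submatrix (fun s => g (s, z)) (fun s => g (s, z))) ≤ traceNorm M := by
  choose U hU h using fun z =>
    exists_unitary_traceNorm_eq (M.submatrix (fun s => g (s, z)) (fun s => g (s, z)))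
  -- The optimal unitaries of the blocks assemble into one unitary, a competitor for the whole
  -- matrix.
  have hW : (blockDiagonal U).submatrix g.symm g.symm ∈ unitaryGroup I ℂ := by
    rw [mem_unitaryGroup_iff, star_eq_conjTranspose, conjTranspose_submatrix,
      submatrix_mul_equiv, blockDiagonal_conjTranspose, ← blockDiagonal_mul]
    have : (fun k => U k * (U k)ᴴ) = 1 := by
      funext k
      exact mem_unitaryGroup_iff.1 (hU k)
    rw [this, blockDiagonal_one, submatrix_one_equiv]
  refine le_trans (le_of_eq ?_) (re_trace_unitary_mul_le hW M)
  simp only [h, trace, diag_apply, mul_apply]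
  rw [← Complex.re_sum, ← Equiv.sum_comp g, Fintype.sum_prod_type, Finset.sum_comm]
  congr 1
  refine Finset.sum_congr rfl fun s _ => Finset.sum_congr rfl fun z _ => ?_
  rw [← Equiv.sum_comp g, Fintype.sum_prod_type]
  refine Finset.sum_congr rfl fun t _ => ?_
  simp [blockDiagonal_apply]

theorem IsState.sqrt_conjTranspose_mul_sqrt {ρ : Matrix S S ℂ} (hρ : IsState ρ) :
    (CFC.sqrt ρ)ᴴ * CFC.sqrt ρ = ρ := by
  rw [(nonneg_iff_posSemidef.1 (CFC.sqrt_nonneg ρ)).1,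
    CFC.sqrt_mul_sqrt_self ρ (nonneg_iff_posSemidef.2 hρ.1)]

/-- A form of the Fuchs–van de Graaf inequality. -/
theorem traceNorm_sub_le_of_mem_purifiedBall {η δ : ℝ} {ρ ρ' : Matrix S S ℂ} (hρ : IsState ρ)
    (h : ρ' ∈ purifiedBall η ρ) (hδ : 0 < δ) (hη : η ≤ δ) : traceNorm (ρ' - ρ) ≤ 3 * δ := by
  obtain ⟨hρ', hP⟩ := h
  obtain ⟨F, hF⟩ : ∃ F, F = fidelity ρ' ρ := ⟨_, rfl⟩
  obtain ⟨Q, hQ⟩ : ∃ Q, Q = CFC.sqrt ρ' := ⟨_, rfl⟩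
  obtain ⟨R, hR⟩ : ∃ R, R = CFC.sqrt ρ := ⟨_, rfl⟩
  have hQs : Qᴴ = Q := hQ ▸ (nonneg_iff_posSemidef.1 (CFC.sqrt_nonneg ρ')).1
  have hRs : Rᴴ = R := hR ▸ (nonneg_iff_posSemidef.1 (CFC.sqrt_nonneg ρ)).1
  have hQQ : Q * Q = ρ' := by rw [← hρ'.sqrt_conjTranspose_mul_sqrt, ← hQ, hQs]
  have hRR : R * R = ρ := by rw [← hρ.sqrt_conjTranspose_mul_sqrt, ← hR, hRs]
  obtain ⟨U, hU, hUF⟩ := exists_unitary_traceNorm_eq (Q * R)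
  have hU1 : Uᴴ * U = 1 := mem_unitaryGroup_iff'.1 hU
  have hFU : F = (U * (Q * R)).trace.re := by rw [← hUF, hF, fidelity, hQ, hR]
  have hF0 : 0 ≤ F := hF ▸ traceNorm_nonneg _
  have ht : (ρ.trace).re = 1 := by rw [hρ.2, Complex.one_re]
  have ht' : (ρ'.trace).re = 1 := by rw [hρ'.2, Complex.one_re]
  have hF1 : F ≤ 1 := by
    have := traceNorm_conjTranspose_mul_le Q R one_pos
    rw [hQs, hRs, hQQ, hRR, ht, ht'] at this
    rw [hF, fidelity, ← hQ, ← hR]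
    linarith
  have hη2 : 0 ≤ η ∧ 1 - F ^ 2 ≤ η ^ 2 := by
    rw [purifiedDistance, ← hF, Real.sqrt_le_iff] at hP
    exact hP
  -- `A * Aᴴ = ρ'` and `Re Tr (Aᴴ * R) = F`
  obtain ⟨A, hA⟩ : ∃ A, A = Q * Uᴴ := ⟨_, rfl⟩
  have hAh : Aᴴ = U * Q := by rw [hA, conjTranspose_mul, conjTranspose_conjTranspose, hQs]
  have hAA : A * Aᴴ = ρ' := by
    rw [hAh, hA, mul_assoc, ← mul_assoc Uᴴ, hU1, one_mul, hQQ]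
  have t1 : (A * Aᴴ).trace.re = 1 := by rw [hAA, ht']
  have t2 : (R * R).trace.re = 1 := by rw [hRR, ht]
  have t3 : (R * Aᴴ).trace.re = F := by rw [trace_mul_comm, hAh, mul_assoc, hFU]
  have t4 : (A * R).trace.re = F := by
    have : A * R = (R * Aᴴ)ᴴ := by rw [conjTranspose_mul, conjTranspose_conjTranspose, hRs]
    rw [this, trace_conjTranspose]
    simpa using t3
  have hsm : ((A - R)ᴴᴴ * (A - R)ᴴ).trace.re = 2 - 2 * F := by
    rw [conjTranspose_conjTranspose, conjTranspose_sub, hRs, sub_mul, mul_sub, mul_sub]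
    simp only [trace_sub, Complex.sub_re, t1, t2, t3, t4]
    ring
  have hsp : ((A + R)ᴴᴴ * (A + R)ᴴ).trace.re = 2 + 2 * F := by
    rw [conjTranspose_conjTranspose, conjTranspose_add, hRs, add_mul, mul_add, mul_add]
    simp only [trace_add, Complex.add_re, t1, t2, t3, t4]
    ring
  -- Symmetrised difference of squares. The factors have squared norms `2 - 2 F ≤ 2 δ²` and `2 + 2 F
  -- ≤ 4`; the weights `δ⁻¹` and `δ` balance them to give `3 δ`.
  have hdec : (2 : ℝ) • (ρ' - ρ) = (A - R)ᴴᴴ * (A + R)ᴴ + (A + R)ᴴᴴ * (A - R)ᴴ := by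
    rw [← hAA, ← hRR, two_smul]
    simp only [conjTranspose_conjTranspose, conjTranspose_add, conjTranspose_sub, hRs]
    noncomm_ring
  have n1 := traceNorm_conjTranspose_mul_le (A - R)ᴴ (A + R)ᴴ (inv_pos.2 hδ)
  have n2 := traceNorm_conjTranspose_mul_le (A + R)ᴴ (A - R)ᴴ hδ
  have n3 := traceNorm_add_le ((A - R)ᴴᴴ * (A + R)ᴴ) ((A + R)ᴴᴴ * (A - R)ᴴ)
  rw [← hdec, traceNorm_smul (by norm_num)] at n3
  rw [hsm, hsp, inv_inv] at n1
  rw [hsm, hsp] at n2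
  have hb : δ⁻¹ * (2 - 2 * F) ≤ 2 * δ := by
    rw [inv_mul_le_iff₀ hδ]
    have : η ^ 2 ≤ δ ^ 2 := pow_le_pow_left₀ hη2.1 hη 2
    nlinarith [hη2.2]
  nlinarith
end TraceNorm

/-! ### Moments of sums of independent samples. -/

section Sampling

variable {Z V : Type*} [Fintype Z] [AddCommGroup V] [Module ℝ V]

theorem sum_fin_succ_fun {M : Type*} [AddCommMonoid M] {K : ℕ} (f : (Fin (K + 1) → Z) → M) :
    ∑ z, f z = ∑ a, ∑ t : Fin K → Z, f (Fin.cons a t) := by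
  rw [← (Fin.consEquiv fun _ => Z).sum_comp, Fintype.sum_prod_type]
  rfl

theorem sum_prod_weight {P : Z → ℝ} (hP : ∑ z, P z = 1) (K : ℕ) :
    ∑ z : Fin K → Z, ∏ i, P (z i) = 1 := by
  induction K with
  | zero => simp
  | succ K ih =>
    rw [sum_fin_succ_fun]
    simp only [Fin.prod_univ_succ, Fin.cons_zero, Fin.cons_succ, ← Finset.mul_sum, ih, mul_one, hP]

/-- The mean of a sum of independent samples. -/
theorem sum_prod_weight_smul_sum {P : Z → ℝ} (hP : ∑ z, P z = 1) (f : Z → V) (K : ℕ) :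
    ∑ z : Fin K → Z, (∏ i, P (z i)) • ∑ i, f (z i) = (K : ℝ) • ∑ z, P z • f z := by
  induction K with
  | zero => simp
  | succ K ih =>
    rw [sum_fin_succ_fun]
    simp only [Fin.prod_univ_succ, Fin.sum_univ_succ, Fin.cons_zero, Fin.cons_succ, smul_add,
      Finset.sum_add_distrib, mul_smul]
    simp only [← Finset.smul_sum, ih, ← Finset.sum_smul, hP, sum_prod_weight hP, one_smul]
    push_cast
    rw [add_smul, one_smul, add_comm]

/-- The second moment of a sum of independent centred samples. -/
theorem sum_prod_weight_mul_bilin {P : Z → ℝ} (hP : ∑ z, P z = 1) (β : LinearMap.BilinForm ℝ V)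
    {h : Z → V} (hh : ∑ z, P z • h z = 0) (K : ℕ) :
    ∑ z : Fin K → Z, (∏ i, P (z i)) * β (∑ i, h (z i)) (∑ i, h (z i))
      = K * ∑ z, P z * β (h z) (h z) := by
  induction K with
  | zero => simp
  | succ K ih =>
    have hmean : ∑ t : Fin K → Z, (∏ i, P (t i)) • ∑ i, h (t i) = 0 := by
      rw [sum_prod_weight_smul_sum hP, hh, smul_zero]
    -- Cross terms between the first sample and the others vanish because the samples are centred.
    have e1 : ∀ v, ∑ t : Fin K → Z, (∏ i, P (t i)) * β v (∑ i, h (t i)) = 0 := fun v => by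
      simpa using congrArg (β v) hmean
    have e2 : ∀ v, ∑ t : Fin K → Z, (∏ i, P (t i)) * β (∑ i, h (t i)) v = 0 := fun v => by
      simpa using congrArg (fun w => β w v) hmean
    rw [sum_fin_succ_fun]
    simp only [Fin.prod_univ_succ, Fin.sum_univ_succ, Fin.cons_zero, Fin.cons_succ, map_add,
      LinearMap.add_apply, mul_add, Finset.sum_add_distrib, mul_assoc, ← Finset.mul_sum, e1, e2, ih]
    simp only [← Finset.sum_mul, sum_prod_weight hP, hP, mul_zero, Finset.sum_const_zero]
    push_cast
    ring_nf

/-- Variance is at most the second moment; the gap is `β m m`. -/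
theorem sum_mul_bilin_centred_le {P : Z → ℝ} (hP : ∑ z, P z = 1) (β : LinearMap.BilinForm ℝ V)
    (hβ : ∀ v, 0 ≤ β v v) (g : Z → V) {m : V} (hm : m = ∑ z, P z • g z) :
    ∑ z, P z * β (g z - m) (g z - m) ≤ ∑ z, P z * β (g z) (g z) := by
  have e1 : ∑ z, P z * β (g z) m = β m m := by
    nth_rewrite 2 [hm]
    simp
  have e2 : ∑ z, P z * β m (g z) = β m m := by
    nth_rewrite 3 [hm]
    simp
  simp only [map_sub, LinearMap.sub_apply, mul_sub, Finset.sum_sub_distrib, e1, e2]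
  rw [← Finset.sum_mul, hP]
  linarith [hβ m]

end Sampling

/-! ### Covering lemma for dominated and approximately dominated ensembles. -/

section Covering

variable {Z S : Type*} [Fintype Z] [Fintype S]

/-- The real part of the Hilbert–Schmidt inner product. -/
noncomputable def hsForm (S : Type*) [Fintype S] : LinearMap.BilinForm ℝ (Matrix S S ℂ) :=
  LinearMap.mk₂ ℝ (fun X Y => (Xᴴ * Y).trace.re)
    (fun X X' Y => by simp [conjTranspose_add, add_mul])
    (fun c X Y => by simp [conjTranspose_smul])
    (fun X Y Y' => by simp [mul_add])
    (fun c X Y => by simp)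

theorem hsForm_apply (X Y : Matrix S S ℂ) : hsForm S X Y = (Xᴴ * Y).trace.re := rfl

theorem hsForm_self_nonneg (X : Matrix S S ℂ) : 0 ≤ hsForm S X X :=
  re_trace_nonneg (posSemidef_conjTranspose_mul_self X)

variable [DecidableEq S]

/-- A positive semidefinite `τ` of trace at most one is dominated by an invertible square of a
Hermitian matrix with trace at most two. -/
theorem exists_invertible_root {τ : Matrix S S ℂ} (hτ : τ.PosSemidef) (hτ1 : τ.trace.re ≤ 1) :
    ∃ R R' : Matrix S S ℂ, Rᴴ = R ∧ R'ᴴ = R' ∧ R * R' = 1 ∧ R' * R = 1 ∧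
      (R * R).trace.re ≤ 2 ∧ (R * R - τ).PosSemidef := by
  -- Adding `e • 1` makes `τ` invertible and raises its trace by less than one.
  obtain ⟨e, he⟩ : ∃ e : ℝ, e = ((Fintype.card S : ℝ) + 1)⁻¹ := ⟨_, rfl⟩
  have he0 : 0 < e := by rw [he]; positivity
  have hT : (τ + e • (1 : Matrix S S ℂ)).PosDef := PosDef.posSemidef_add hτ (PosDef.one.smul he0)
  obtain ⟨R, hR⟩ : ∃ R, R = CFC.sqrt (τ + e • (1 : Matrix S S ℂ)) := ⟨_, rfl⟩
  have hRR : R * R = τ + e • (1 : Matrix S S ℂ) := by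
    rw [hR]
    exact CFC.sqrt_mul_sqrt_self _ (nonneg_iff_posSemidef.2 hT.posSemidef)
  have hRh : Rᴴ = R := (nonneg_iff_posSemidef.1 (hR ▸ CFC.sqrt_nonneg _)).1
  have hdet : IsUnit R.det := by
    have := (isUnit_iff_isUnit_det _).1 hT.isUnit
    rw [← hRR, det_mul] at this
    exact isUnit_of_mul_isUnit_left this
  refine ⟨R, R⁻¹, hRh, by rw [conjTranspose_nonsing_inv, hRh], mul_nonsing_inv _ hdet,
    nonsing_inv_mul _ hdet, ?_, ?_⟩
  · rw [hRR, trace_add, trace_smul, trace_one, Complex.add_re, Complex.real_smul,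
      Complex.re_ofReal_mul, Complex.natCast_re]
    have : e * (Fintype.card S : ℝ) ≤ 1 := by
      rw [he, inv_mul_le_iff₀ (by positivity)]
      linarith
    linarith
  · rw [hRR, add_sub_cancel_left]
    exact PosSemidef.one.smul he0.le

/-- For `B = R' s R'` the domination reads `0 ≤ B ≤ l • 1`, hence `B² ≤ l • B`. Conjugating by `R`
and taking traces gives the claim. -/
theorem hsForm_inv_root_mul_le {R R' s : Matrix S S ℂ} (hR : Rᴴ = R) (hR' : R'ᴴ = R')
    (h1 : R * R' = 1) (h2 : R' * R = 1) (hs : s.PosSemidef) {l : ℝ}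
    (hls : (l • (R * R) - s).PosSemidef) : hsForm S (R' * s) (R' * s) ≤ l * s.trace.re := by
  obtain ⟨B, hB⟩ : ∃ B, B = R' * s * R' := ⟨_, rfl⟩
  have hB0 : B.PosSemidef := by
    have := hs.mul_mul_conjTranspose_same R'
    rwa [hR', ← hB] at this
  have hB1 : (l • (1 : Matrix S S ℂ) - B).PosSemidef := by
    have := hls.mul_mul_conjTranspose_same R'
    rwa [hR', mul_sub, sub_mul, ← hB, mul_smul_comm, smul_mul_assoc, ← mul_assoc, h2, one_mul,
      h1] at this
  obtain ⟨N, hN⟩ : ∃ N, N = CFC.sqrt B := ⟨_, rfl⟩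
  have hNN : N * N = B := hN ▸ CFC.sqrt_mul_sqrt_self B (nonneg_iff_posSemidef.2 hB0)
  have hNh : Nᴴ = N := (nonneg_iff_posSemidef.1 (hN ▸ CFC.sqrt_nonneg _)).1
  have hBB : (l • B - B * B).PosSemidef := by
    have := hB1.mul_mul_conjTranspose_same N
    rw [hNh, mul_sub, sub_mul, mul_smul_comm, smul_mul_assoc, mul_one, hNN] at this
    have e : N * B * N = B * B := by rw [← hNN]; simp only [mul_assoc]
    rwa [e] at this
  have key := re_trace_nonneg (hBB.mul_mul_conjTranspose_same R)
  have e1 : R * B * R = s := by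
    rw [hB, ← mul_assoc, ← mul_assoc, h1, one_mul, mul_assoc, h2, mul_one]
  have e2 : R * (B * B) * R = (R' * s)ᴴ * (R' * s) := by
    rw [hB, conjTranspose_mul, hR', hs.1]
    calc R * (R' * s * R' * (R' * s * R')) * R
        = (R * R') * s * R' * (R' * s) * (R' * R) := by simp only [mul_assoc]
      _ = s * R' * (R' * s) := by rw [h1, h2, one_mul, mul_one]
  rw [hR, mul_sub, sub_mul, mul_smul_comm, smul_mul_assoc, e1, e2, trace_sub, trace_smul,
    Complex.sub_re, Complex.real_smul, Complex.re_ofReal_mul] at key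
  rw [hsForm_apply]
  linarith

/-- The covering lemma for an ensemble `s` dominated by `l • τ`. -/
theorem covering_of_dominated {P : Z → ℝ} (hP0 : ∀ z, 0 ≤ P z) (hP : ∑ z, P z = 1)
    {s : Z → Matrix S S ℂ} {τ : Matrix S S ℂ} (hτ : τ.PosSemidef) (hτ1 : τ.trace.re ≤ 1)
    (hs : ∀ z, (s z).PosSemidef) {l c : ℝ} (hl : 0 ≤ l) (hc : 0 < c)
    (hls : ∀ z, (l • τ - s z).PosSemidef) {K : ℕ} (hK : 0 < K) :
    ∑ z : Fin K → Z, (∏ i, P (z i)) *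
        traceNorm ((1 / (K : ℝ)) • ∑ i, s (z i) - ∑ z, P z • s z)
      ≤ (c * 2 + c⁻¹ * (l / K * ∑ z, P z * (s z).trace.re)) / 2 := by
  obtain ⟨R, R', hR, hR', h1, h2, htr, hRτ⟩ := exists_invertible_root hτ hτ1
  have hK' : (0 : ℝ) < K := by exact_mod_cast hK
  have hls' : ∀ z, (l • (R * R) - s z).PosSemidef := fun z => by
    have := (hRτ.smul hl).add (hls z)
    rwa [smul_sub, sub_add_sub_cancel] at this
  obtain ⟨g, hg⟩ : ∃ g : Z → Matrix S S ℂ, g = fun z => R' * s z := ⟨_, rfl⟩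
  have hRg : ∀ z, R * g z = s z := fun z => by rw [hg, ← mul_assoc, h1, one_mul]
  obtain ⟨m, hm⟩ : ∃ m, m = ∑ z, P z • g z := ⟨_, rfl⟩
  have hRm : R * m = ∑ z, P z • s z := by
    simp only [hm, Finset.mul_sum, mul_smul_comm, hRg]
  have hcent : ∑ z, P z • (g z - m) = 0 := by
    simp only [smul_sub, Finset.sum_sub_distrib, ← Finset.sum_smul, hP, one_smul, ← hm, sub_self]
  -- Factoring out `R` leaves a centred sum, ready for Cauchy–Schwarz against `Tr R² ≤ 2`.
  have hsplit : ∀ z : Fin K → Z, (1 / (K : ℝ)) • ∑ i, s (z i) - ∑ z, P z • s z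
      = Rᴴ * ((1 / (K : ℝ)) • ∑ i, (g (z i) - m)) := fun z => by
    rw [hR, Finset.sum_sub_distrib, Finset.sum_const, Finset.card_univ, Fintype.card_fin, smul_sub,
      mul_sub, ← Nat.cast_smul_eq_nsmul ℝ, smul_smul, one_div_mul_cancel hK'.ne', one_smul, hRm,
      mul_smul_comm, Finset.mul_sum]
    simp only [hRg]
  have hbound : ∀ z : Fin K → Z, traceNorm ((1 / (K : ℝ)) • ∑ i, s (z i) - ∑ z, P z • s z)
      ≤ (c * 2 + c⁻¹ * ((1 / K) ^ 2 *
          hsForm S (∑ i, (g (z i) - m)) (∑ i, (g (z i) - m)))) / 2 := fun z => by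
    rw [hsplit]
    refine (traceNorm_conjTranspose_mul_le _ _ hc).trans ?_
    rw [← hsForm_apply ((1 / (K : ℝ)) • ∑ i, (g (z i) - m)), hR]
    simp only [map_smul, LinearMap.smul_apply, smul_eq_mul]
    have := mul_le_mul_of_nonneg_left htr hc.le
    linarith
  have hvar : ∑ z, P z * hsForm S (g z - m) (g z - m) ≤ l * ∑ z, P z * (s z).trace.re := by
    refine (sum_mul_bilin_centred_le hP (hsForm S) hsForm_self_nonneg g hm).trans ?_
    rw [Finset.mul_sum]
    refine Finset.sum_le_sum fun z _ => ?_
    have := mul_le_mul_of_nonneg_left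
      (hsForm_inv_root_mul_le hR hR' h1 h2 (hs z) (hls' z)) (hP0 z)
    rw [hg]
    linarith
  calc _ ≤ ∑ z : Fin K → Z, (∏ i, P (z i)) * ((c * 2 + c⁻¹ * ((1 / K) ^ 2 *
          hsForm S (∑ i, (g (z i) - m)) (∑ i, (g (z i) - m)))) / 2) :=
        Finset.sum_le_sum fun z _ =>
          mul_le_mul_of_nonneg_left (hbound z) (Finset.prod_nonneg fun i _ => hP0 _)
    _ = (c * 2 * ∑ z : Fin K → Z, (∏ i, P (z i)) + c⁻¹ * ((1 / K) ^ 2 *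
          ∑ z : Fin K → Z, (∏ i, P (z i)) *
            hsForm S (∑ i, (g (z i) - m)) (∑ i, (g (z i) - m)))) / 2 := by
        rw [Finset.mul_sum, Finset.mul_sum, Finset.mul_sum, ← Finset.sum_add_distrib,
          Finset.sum_div]
        exact Finset.sum_congr rfl fun z _ => by ring
    _ = (c * 2 + c⁻¹ * (1 / K * ∑ z, P z * hsForm S (g z - m) (g z - m))) / 2 := by
        rw [sum_prod_weight hP, sum_prod_weight_mul_bilin hP (hsForm S) hcent]
        field_simp
    _ ≤ _ := by
        have : 1 / (K : ℝ) * ∑ z, P z * hsForm S (g z - m) (g z - m)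
            ≤ l / K * ∑ z, P z * (s z).trace.re := by
          rw [div_mul_eq_mul_div, div_mul_eq_mul_div, one_mul]
          gcongr
        gcongr

/-- The covering lemma for an ensemble `r` that is approximated on average by an ensemble `s`
dominated by `l • τ`. -/
theorem covering_of_approx {P : Z → ℝ} (hP0 : ∀ z, 0 ≤ P z) (hP : ∑ z, P z = 1)
    (r : Z → Matrix S S ℂ)
    {s : Z → Matrix S S ℂ} {τ : Matrix S S ℂ} (hτ : τ.PosSemidef) (hτ1 : τ.trace.re ≤ 1)
    (hs : ∀ z, (s z).PosSemidef) {l c : ℝ} (hl : 0 ≤ l) (hc : 0 < c)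
    (hls : ∀ z, (l • τ - s z).PosSemidef) {K : ℕ} (hK : 0 < K) :
    ∑ z : Fin K → Z, (∏ i, P (z i)) *
        traceNorm ((1 / (K : ℝ)) • ∑ i, r (z i) - ∑ z, P z • r z)
      ≤ (c * 2 + c⁻¹ * (l / K * ∑ z, P z * (s z).trace.re)) / 2
        + 2 * ∑ z, P z * traceNorm (r z - s z) := by
  have hK' : (0 : ℝ) < K := by exact_mod_cast hK
  have hmean : traceNorm (∑ z, P z • s z - ∑ z, P z • r z)
      ≤ ∑ z, P z * traceNorm (r z - s z) := by
    rw [traceNorm_sub_comm, ← Finset.sum_sub_distrib]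
    refine (traceNorm_sum_le _ _).trans (Finset.sum_le_sum fun z _ => ?_)
    rw [← smul_sub, traceNorm_smul (hP0 z)]
  have hpt : ∀ z : Fin K → Z, traceNorm ((1 / (K : ℝ)) • ∑ i, r (z i) - ∑ z, P z • r z)
      ≤ traceNorm ((1 / (K : ℝ)) • ∑ i, s (z i) - ∑ z, P z • s z)
        + 1 / K * ∑ i, traceNorm (r (z i) - s (z i))
        + ∑ z, P z * traceNorm (r z - s z) := fun z => by
    have e : (1 / (K : ℝ)) • ∑ i, r (z i) - ∑ z, P z • r z
        = (((1 / (K : ℝ)) • ∑ i, s (z i) - ∑ z, P z • s z)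
          + (1 / (K : ℝ)) • ∑ i, (r (z i) - s (z i))) + (∑ z, P z • s z - ∑ z, P z • r z) := by
      rw [Finset.sum_sub_distrib, smul_sub]
      abel
    rw [e]
    refine (traceNorm_add_le _ _).trans (add_le_add ((traceNorm_add_le _ _).trans
      (add_le_add le_rfl ?_)) hmean)
    rw [traceNorm_smul (by positivity)]
    gcongr
    exact traceNorm_sum_le _ _
  have hdev : ∑ z : Fin K → Z, (∏ i, P (z i)) * (1 / K * ∑ i, traceNorm (r (z i) - s (z i)))
      = ∑ z, P z * traceNorm (r z - s z) := by
    have := sum_prod_weight_smul_sum hP (fun z => traceNorm (r z - s z)) K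
    simp only [smul_eq_mul] at this
    simp only [mul_left_comm _ (1 / (K : ℝ))]
    rw [← Finset.mul_sum, this, ← mul_assoc, one_div_mul_cancel hK'.ne', one_mul]
  calc _ ≤ ∑ z : Fin K → Z, (∏ i, P (z i)) *
        (traceNorm ((1 / (K : ℝ)) • ∑ i, s (z i) - ∑ z, P z • s z)
        + 1 / K * ∑ i, traceNorm (r (z i) - s (z i))
        + ∑ z, P z * traceNorm (r z - s z)) := Finset.sum_le_sum fun z _ =>
          mul_le_mul_of_nonneg_left (hpt z) (Finset.prod_nonneg fun i _ => hP0 _)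
    _ ≤ _ := by
      simp only [mul_add, Finset.sum_add_distrib, hdev]
      rw [← Finset.sum_mul, sum_prod_weight hP]
      have := covering_of_dominated hP0 hP hτ hτ1 hs hl hc hls hK
      linarith

end Covering

/-! ### From smooth max information to a dominated ensemble. -/

/-- The slack `+ 1` puts the threshold strictly above the infimum, so a witness exists without
showing that the infimum is attained. -/
theorem exists_of_smoothMaxInfo_add_le {A B : Type*} [Fintype A] [DecidableEq A] [Fintype B]
    [DecidableEq B] {η a b : ℝ} {M : Matrix (A × B) (A × B) ℂ}
    (h : smoothMaxInfo η M + (a : EReal) ≤ (b : EReal)) :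
    ∃ M' ∈ purifiedBall η M, ∃ l : ℝ, l ≤ b - a + 1 ∧
      (((2 : ℝ) ^ l) • (marginalFst M ⊗ₖ marginalSnd M) - M').PosSemidef := by
  have h1 : smoothMaxInfo η M < ((b - a + 1 : ℝ) : EReal) := by
    have h2 : smoothMaxInfo η M ≤ ((b - a : ℝ) : EReal) := by
      rw [EReal.coe_sub]
      exact EReal.le_sub_iff_add_le (Or.inl (EReal.coe_ne_bot a)) (Or.inl (EReal.coe_ne_top a)) |>.2 h
    exact h2.trans_lt (EReal.coe_lt_coe_iff.2 (by linarith))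
  simp only [smoothMaxInfo, smoothMaxRelEntropy, maxRelEntropy, iInf_lt_iff] at h1
  obtain ⟨M', hM', l, hl, hlt⟩ := h1
  exact ⟨M', hM', l, (EReal.coe_lt_coe_iff.1 hlt).le, hl⟩

/-- For `δ ≤ 1` the `log δ` term only helps and is dropped. The factor 2 from the slack is absorbed
by the 3: `2 ^ l ≤ K * (2/3) ε³ ≤ K δ²`. -/
theorem two_rpow_le_mul_sq {l ε δ : ℝ} {K : ℕ} (hK : 0 < K) (hε : 0 < ε) (hεδ : ε < δ)
    (hδ : δ ≤ 1)
    (h : l ≤ Real.logb 2 K - (Real.logb 2 (3 / ε ^ 3) - 1 / 4 * Real.logb 2 δ) + 1) :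
    (2 : ℝ) ^ l ≤ K * δ ^ 2 := by
  have hK' : (0 : ℝ) < K := by exact_mod_cast hK
  have hδ0 : 0 < δ := hε.trans hεδ
  have hlog : Real.logb 2 δ ≤ 0 := Real.logb_nonpos one_lt_two hδ0.le hδ
  have e : Real.logb 2 (K / (3 / ε ^ 3) * 2)
      = Real.logb 2 K - Real.logb 2 (3 / ε ^ 3) + 1 := by
    rw [Real.logb_mul (by positivity) (by norm_num), Real.logb_div hK'.ne' (by positivity),
      Real.logb_self_eq_one one_lt_two]
  have h1 : (2 : ℝ) ^ l ≤ K / (3 / ε ^ 3) * 2 := by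
    rw [← Real.le_logb_iff_rpow_le one_lt_two (by positivity), e]
    linarith
  have h2 : (K : ℝ) / (3 / ε ^ 3) * 2 = K * (2 / 3 * ε ^ 3) := by field_simp
  have h3 : ε ^ 3 ≤ δ ^ 3 := pow_le_pow_left₀ hε.le hεδ.le 3
  have h4 : δ ^ 3 ≤ δ ^ 2 := pow_le_pow_of_le_one hδ0.le hδ (by norm_num)
  have h5 : 0 ≤ ε ^ 3 := by positivity
  rw [h2] at h1
  exact h1.trans (mul_le_mul_of_nonneg_left (by linarith) hK'.le)

/-- A state near a block state and dominated by `l • σ` yields an ensemble near the blocks and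
dominated by the blocks of `l • σ`. -/
theorem exists_dominated_ensemble {I Z S : Type*} [Fintype I] [DecidableEq I] [Fintype Z]
    [DecidableEq Z] [Fintype S] [DecidableEq S] (g : S × Z ≃ I) {M M' σ : Matrix I I ℂ}
    (hM : IsState M) {p : Z → ℝ} (hp : ∀ z, 0 ≤ p z) {r τ : Z → Matrix S S ℂ}
    (hr : ∀ z, M.submatrix (fun s => g (s, z)) (fun s => g (s, z)) = p z • r z)
    (hσ : ∀ z, σ.submatrix (fun s => g (s, z)) (fun s => g (s, z)) = p z • τ z)
    (hτ : ∀ z, (τ z).PosSemidef) {η δ l : ℝ} (hδ : 0 < δ) (hη : η ≤ δ) (hl : 0 ≤ l)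
    (hM' : M' ∈ purifiedBall η M) (h : (l • σ - M').PosSemidef) :
    ∃ s : Z → Matrix S S ℂ, (∀ z, (s z).PosSemidef) ∧ (∀ z, (l • τ z - s z).PosSemidef) ∧
      ∑ z, p z * traceNorm (r z - s z) ≤ 3 * δ ∧ ∑ z, p z * (s z).trace.re ≤ 1 := by
  have hb0 : ∀ z, (M'.submatrix (fun s => g (s, z)) (fun s => g (s, z))).PosSemidef :=
    fun z => hM'.1.1.submatrix _
  -- Where `p z = 0`, the convention `0⁻¹ = 0` makes the block zero; it is still dominated and
  -- carries no weight.
  refine ⟨fun z => (p z)⁻¹ • M'.submatrix (fun s => g (s, z)) (fun s => g (s, z)),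
    fun z => (hb0 z).smul (inv_nonneg.2 (hp z)), fun z => ?_, ?_, ?_⟩
  · rcases eq_or_ne (p z) 0 with hz | hz
    · simpa [hz] using (hτ z).smul hl
    · have := (h.submatrix (fun s => g (s, z))).smul (inv_nonneg.2 (hp z))
      rw [submatrix_sub, submatrix_smul, Pi.sub_apply, Pi.sub_apply, Pi.smul_apply, Pi.smul_apply,
        hσ, smul_sub, smul_comm l, inv_smul_smul₀ hz] at this
      exact this
  · refine le_trans ?_ (traceNorm_sub_le_of_mem_purifiedBall hM hM' hδ hη)
    refine le_trans (Finset.sum_le_sum fun z _ => ?_) (sum_traceNorm_block_le g (M' - M))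
    rcases eq_or_ne (p z) 0 with hz | hz
    · rw [hz, zero_mul]
      exact traceNorm_nonneg _
    · rw [← traceNorm_smul (hp z), smul_sub, smul_inv_smul₀ hz, ← hr, traceNorm_sub_comm]
      exact le_rfl
  · have e : ∑ z, (M'.submatrix (fun s => g (s, z)) (fun s => g (s, z))).trace.re = 1 := by
      rw [← Complex.one_re, ← hM'.1.2, ← Complex.re_sum]
      simp only [trace, diag_apply, submatrix_apply]
      rw [← Equiv.sum_comp g, Fintype.sum_prod_type, Finset.sum_comm]
    rw [← e]
    refine Finset.sum_le_sum fun z _ => ?_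
    rw [trace_smul, Complex.real_smul, Complex.re_ofReal_mul, ← mul_assoc]
    have := re_trace_nonneg (hb0 z)
    rcases eq_or_ne (p z) 0 with hz | hz
    · simpa [hz] using this
    · rw [mul_inv_cancel₀ hz, one_mul]

theorem isState_sum_smul {Z S : Type*} [Fintype Z] [Fintype S] {P : Z → ℝ}
    (hP : P ∈ stdSimplex ℝ Z) {r : Z → Matrix S S ℂ} (hr : ∀ z, IsState (r z)) :
    IsState (∑ z, P z • r z) := by
  refine ⟨posSemidef_sum _ fun z _ => (hr z).1.smul (hP.1 z), ?_⟩
  simp only [trace_sum, trace_smul, (hr _).2, Complex.real_smul, mul_one]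
  exact_mod_cast hP.2

theorem IsState.traceNorm_eq {S : Type*} [Fintype S] [DecidableEq S] {ρ : Matrix S S ℂ}
    (hρ : IsState ρ) : traceNorm ρ = 1 := by
  rw [traceNorm_of_posSemidef hρ.1, hρ.2, Complex.one_re]

theorem IsState.marginalSnd {C E : Type*} [Fintype C] [Fintype E] {ρ : Matrix (C × E) (C × E) ℂ}
    (hρ : IsState ρ) : IsState (marginalSnd ρ) := by
  constructor
  · have : CQMAC.marginalSnd ρ = ∑ c, ρ.submatrix (fun e => (c, e)) (fun e => (c, e)) := by
      ext e e'
      simp [CQMAC.marginalSnd, Matrix.sum_apply]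
    rw [this]
    exact posSemidef_sum _ fun c _ => hρ.1.submatrix _
  · rw [← hρ.2]
    simp only [trace, diag_apply, CQMAC.marginalSnd]
    rw [Fintype.sum_prod_type, Finset.sum_comm]

theorem posSemidef_single_one {W : Type*} [Fintype W] [DecidableEq W] (w : W) :
    (Matrix.single w w (1 : ℂ)).PosSemidef := by
  rw [← diagonal_single]
  exact PosSemidef.diagonal (Pi.single_nonneg.2 zero_le_one)

theorem isState_mean_snd {X Y C E : Type*} [Fintype Y] [Fintype C] [Fintype E] {PY : Y → ℝ}
    (hY : PY ∈ stdSimplex ℝ Y) {ρ : X → Y → Matrix (C × E) (C × E) ℂ}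
    (hρ : ∀ x y, IsState (ρ x y)) (x : X) : IsState (∑ y, PY y • marginalSnd (ρ x y)) :=
  isState_sum_smul hY fun y => (hρ x y).marginalSnd

/-! ### Marginals of the control state and their classical blocks. -/

section ControlState

variable {X Y C E : Type*} [Fintype X] [DecidableEq X] [Fintype Y] [DecidableEq Y]

theorem controlState_apply (PX : X → ℝ) (PY : Y → ℝ) (ρ : X → Y → Matrix (C × E) (C × E) ℂ)
    (x x' : X) (y y' : Y) (c c' : C) (e e' : E) :
    controlState PX PY ρ (x, y, c, e) (x', y', c', e')
      = if x = x' ∧ y = y' then (PX x * PY y : ℂ) * ρ x y (c, e) (c', e') else 0 := by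
  simp only [controlState, Matrix.sum_apply, Matrix.smul_apply, kronecker_apply,
    Matrix.single_apply]
  rw [Finset.sum_eq_single x, Finset.sum_eq_single y]
  · by_cases hx : x = x' <;> by_cases hy : y = y' <;> simp [hx, hy]
  · intro b _ hb
    simp [hb]
  · simp
  · intro b _ hb
    simp [hb]
  · simp

theorem posSemidef_controlState [Fintype C] [Fintype E] {PX : X → ℝ} {PY : Y → ℝ}
    (hX : ∀ x, 0 ≤ PX x) (hY : ∀ y, 0 ≤ PY y)
    {ρ : X → Y → Matrix (C × E) (C × E) ℂ} (hρ : ∀ x y, (ρ x y).PosSemidef) :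
    (controlState PX PY ρ).PosSemidef := by
  classical
  exact posSemidef_sum _ fun x _ => posSemidef_sum _ fun y _ =>
    ((posSemidef_single_one x).kronecker ((posSemidef_single_one y).kronecker (hρ x y))).smul (mul_nonneg (hX x) (hY y))

variable [Fintype C] (PX : X → ℝ) (PY : Y → ℝ) (ρ : X → Y → Matrix (C × E) (C × E) ℂ)

theorem marginalXE_controlState_apply (x x' : X) (e e' : E) :
    marginalXE (controlState PX PY ρ) (x, e) (x', e')
      = if x = x' then (PX x • ∑ y, PY y • marginalSnd (ρ x y)) e e' else 0 := by
  simp only [marginalXE, controlState_apply, marginalSnd, Matrix.sum_apply, Matrix.smul_apply, Complex.real_smul]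
  by_cases h : x = x'
  · simp [h, Finset.mul_sum, mul_assoc]
  · simp [h]

theorem marginalYEX_controlState_apply (x x' : X) (y y' : Y) (e e' : E) :
    marginalYEX (controlState PX PY ρ) (y, e, x) (y', e', x')
      = if x = x' ∧ y = y' then ((PX x * PY y) • marginalSnd (ρ x y)) e e' else 0 := by
  simp only [marginalYEX, controlState_apply, marginalSnd, Matrix.smul_apply, Complex.real_smul]
  split_ifs with h
  · simp [Finset.mul_sum, mul_assoc]
  · simp

theorem marginalE_controlState :
    marginalE (controlState PX PY ρ) = ∑ x, PX x • ∑ y, PY y • marginalSnd (ρ x y) := by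
  ext e e'
  simp [marginalE, controlState_apply, marginalSnd, Matrix.sum_apply, Matrix.smul_apply, Finset.mul_sum,
    mul_assoc]

theorem marginalSnd_marginalXE_controlState :
    marginalSnd (marginalXE (controlState PX PY ρ))
      = ∑ x, PX x • ∑ y, PY y • marginalSnd (ρ x y) := by
  ext e e'
  rw [Matrix.sum_apply]
  simp only [marginalSnd.eq_1 (marginalXE _), marginalXE_controlState_apply, if_true]

/-- Entries diagonal in `X` suffice, since only blocks at fixed `(x, y)` are compared. -/
theorem marginalSnd_marginalYEX_controlState_apply (x : X) (e e' : E) :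
    marginalSnd (marginalYEX (controlState PX PY ρ)) (e, x) (e', x)
      = (PX x • ∑ y, PY y • marginalSnd (ρ x y)) e e' := by
  rw [marginalSnd.eq_1 (marginalYEX _)]
  simp only [marginalYEX_controlState_apply, and_self, if_true, Matrix.smul_apply, Matrix.sum_apply,
    Complex.real_smul, Complex.ofReal_mul, Finset.mul_sum, mul_assoc]

variable {PX PY ρ} [Fintype E]

theorem marginalFst_marginalXE_controlState_apply (hY : PY ∈ stdSimplex ℝ Y)
    (hρ : ∀ x y, IsState (ρ x y)) (x : X) :
    marginalFst (marginalXE (controlState PX PY ρ)) x x = PX x := by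
  simp only [marginalFst, marginalXE_controlState_apply, if_true]
  have : (PX x • ∑ y, PY y • marginalSnd (ρ x y)).trace = PX x := by
    rw [trace_smul, (isState_mean_snd hY hρ x).2, Complex.real_smul, mul_one]
  exact this

theorem marginalFst_marginalYEX_controlState_apply (hX : PX ∈ stdSimplex ℝ X)
    (hρ : ∀ x y, IsState (ρ x y)) (y : Y) :
    marginalFst (marginalYEX (controlState PX PY ρ)) y y = PY y := by
  simp only [marginalFst, Fintype.sum_prod_type, marginalYEX_controlState_apply, and_self, if_true]
  rw [Finset.sum_comm]
  have : ∀ x, ∑ e, ((PX x * PY y) • marginalSnd (ρ x y)) e e = (PX x * PY y : ℂ) := fun x => by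
    have : ((PX x * PY y) • marginalSnd (ρ x y)).trace = (PX x * PY y : ℂ) := by
      rw [trace_smul, (hρ x y).marginalSnd.2, Complex.real_smul, mul_one, Complex.ofReal_mul]
    exact this
  simp only [this]
  rw [← Finset.sum_mul, ← Complex.ofReal_sum, hX.2, Complex.ofReal_one, one_mul]

theorem isState_marginalXE_controlState (hX : PX ∈ stdSimplex ℝ X) (hY : PY ∈ stdSimplex ℝ Y)
    (hρ : ∀ x y, IsState (ρ x y)) : IsState (marginalXE (controlState PX PY ρ)) := by
  constructor
  · have : marginalXE (controlState PX PY ρ) = ∑ y, ∑ c, (controlState PX PY ρ).submatrix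
        (fun s : X × E => (s.1, y, c, s.2)) (fun s : X × E => (s.1, y, c, s.2)) := by
      ext s t
      simp [marginalXE, Matrix.sum_apply]
    rw [this]
    exact posSemidef_sum _ fun y _ => posSemidef_sum _ fun c _ =>
      (posSemidef_controlState hX.1 hY.1 fun x y => (hρ x y).1).submatrix _
  · have : (marginalXE (controlState PX PY ρ)).trace
        = ∑ x, marginalFst (marginalXE (controlState PX PY ρ)) x x := by
      simp [trace, marginalFst, Fintype.sum_prod_type]
    rw [this]
    simp only [marginalFst_marginalXE_controlState_apply hY hρ]
    exact_mod_cast hX.2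

theorem isState_marginalYEX_controlState (hX : PX ∈ stdSimplex ℝ X) (hY : PY ∈ stdSimplex ℝ Y)
    (hρ : ∀ x y, IsState (ρ x y)) : IsState (marginalYEX (controlState PX PY ρ)) := by
  constructor
  · have : marginalYEX (controlState PX PY ρ) = ∑ c, (controlState PX PY ρ).submatrix
        (fun s : Y × E × X => (s.2.2, s.1, c, s.2.1))
        (fun s : Y × E × X => (s.2.2, s.1, c, s.2.1)) := by
      ext s t
      simp [marginalYEX, Matrix.sum_apply]
    rw [this]
    exact posSemidef_sum _ fun c _ =>
      (posSemidef_controlState hX.1 hY.1 fun x y => (hρ x y).1).submatrix _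
  · have : (marginalYEX (controlState PX PY ρ)).trace
        = ∑ y, marginalFst (marginalYEX (controlState PX PY ρ)) y y := by
      simp only [trace, marginalFst, diag_apply]
      rw [Fintype.sum_prod_type]
    rw [this]
    simp only [marginalFst_marginalYEX_controlState_apply hX hρ]
    exact_mod_cast hY.2

/-! ### The two one-index covering bounds. -/

variable [DecidableEq E] {δ ε : ℝ}

/-- Covering of the marginal on `E` by sampling `X`. -/
theorem covering_fst (hX : PX ∈ stdSimplex ℝ X) (hY : PY ∈ stdSimplex ℝ Y)
    (hρ : ∀ x y, IsState (ρ x y)) (hε : 0 < ε) (hεδ : ε < δ) (hδ1 : δ ≤ 1) {K : ℕ} (hK : 0 < K)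
    (h : smoothMaxInfo (δ - ε) (marginalXE (controlState PX PY ρ))
        + ((Real.logb 2 (3 / ε ^ 3) - 1 / 4 * Real.logb 2 δ : ℝ) : EReal)
      ≤ ((Real.logb 2 K : ℝ) : EReal)) :
    ∑ x : Fin K → X, (∏ i, PX (x i)) *
        traceNorm ((1 / (K : ℝ)) • ∑ i, ∑ y, PY y • marginalSnd (ρ (x i) y)
          - ∑ x, PX x • ∑ y, PY y • marginalSnd (ρ x y)) ≤ 8 * δ := by
  have hδ : 0 < δ := hε.trans hεδ
  have hK' : (0 : ℝ) < K := by exact_mod_cast hK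
  obtain ⟨M', hM', l, hl, hdom⟩ := exists_of_smoothMaxInfo_add_le h
  have hlK := two_rpow_le_mul_sq hK hε hεδ hδ1 hl
  have hl0 : (0 : ℝ) ≤ 2 ^ l := by positivity
  have hmean := isState_sum_smul hX fun x => isState_mean_snd hY hρ x
  obtain ⟨s, hs, hls, hdist, htr⟩ := exists_dominated_ensemble (Equiv.prodComm E X)
    (isState_marginalXE_controlState hX hY hρ) hX.1
    (r := fun x => ∑ y, PY y • marginalSnd (ρ x y))
    (τ := fun _ => ∑ x, PX x • ∑ y, PY y • marginalSnd (ρ x y))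
    (fun x => by
      ext e e'
      simp only [submatrix_apply, Equiv.prodComm_apply, Prod.swap_prod_mk,
        marginalXE_controlState_apply, if_true])
    (fun x => by
      ext e e'
      simp only [submatrix_apply, Equiv.prodComm_apply, Prod.swap_prod_mk, kronecker_apply,
        marginalFst_marginalXE_controlState_apply hY hρ, marginalSnd_marginalXE_controlState,
        Matrix.smul_apply, Complex.real_smul])
    (fun _ => hmean.1) hδ (by linarith) hl0 hM' hdom
  -- With `c = δ` and `2 ^ l / K ≤ δ²` the total is `(2 δ + δ) / 2 + 2 * (3 δ) = 7.5 δ`.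
  have hcov := covering_of_approx hX.1 hX.2 (fun x => ∑ y, PY y • marginalSnd (ρ x y)) hmean.1
    (by rw [hmean.2, Complex.one_re]) hs hl0 hδ hls hK
  have h1 : (2 : ℝ) ^ l / K * ∑ x, PX x * (s x).trace.re ≤ δ ^ 2 := by
    have h2 : (2 : ℝ) ^ l / K ≤ δ ^ 2 := by
      rw [div_le_iff₀ hK']
      linarith
    have h3 : 0 ≤ (2 : ℝ) ^ l / K := by positivity
    nlinarith
  have h4 : δ⁻¹ * ((2 : ℝ) ^ l / K * ∑ x, PX x * (s x).trace.re) ≤ δ := by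
    rw [inv_mul_le_iff₀ hδ]
    linarith
  linarith

/-- Covering of the marginals on `E` conditioned on `X` by sampling `Y`. -/
theorem covering_snd (hX : PX ∈ stdSimplex ℝ X) (hY : PY ∈ stdSimplex ℝ Y)
    (hρ : ∀ x y, IsState (ρ x y)) (hε : 0 < ε) (hεδ : ε < δ) (hδ1 : δ ≤ 1) {K : ℕ} (hK : 0 < K)
    (h : smoothMaxInfo (δ - ε) (marginalYEX (controlState PX PY ρ))
        + ((Real.logb 2 (3 / ε ^ 3) - 1 / 4 * Real.logb 2 δ : ℝ) : EReal)
      ≤ ((Real.logb 2 K : ℝ) : EReal)) :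
    ∑ x, PX x * ∑ y : Fin K → Y, (∏ j, PY (y j)) *
        traceNorm ((1 / (K : ℝ)) • ∑ j, marginalSnd (ρ x (y j))
          - ∑ y, PY y • marginalSnd (ρ x y)) ≤ 8 * δ := by
  have hδ : 0 < δ := hε.trans hεδ
  have hK' : (0 : ℝ) < K := by exact_mod_cast hK
  obtain ⟨M', hM', l, hl, hdom⟩ := exists_of_smoothMaxInfo_add_le h
  have hlK := two_rpow_le_mul_sq hK hε hεδ hδ1 hl
  have hl0 : (0 : ℝ) ≤ 2 ^ l := by positivity
  have hmean := isState_mean_snd hY hρ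
  let g : E × (X × Y) ≃ Y × (E × X) :=
    ⟨fun t => (t.2.2, t.1, t.2.1), fun t => (t.2.1, t.2.2, t.1), fun _ => rfl, fun _ => rfl⟩
  obtain ⟨s, hs, hls, hdist, htr⟩ := exists_dominated_ensemble g
    (isState_marginalYEX_controlState hX hY hρ)
    (p := fun z => PX z.1 * PY z.2) (fun z => mul_nonneg (hX.1 _) (hY.1 _))
    (r := fun z => marginalSnd (ρ z.1 z.2))
    (τ := fun z => ∑ y, PY y • marginalSnd (ρ z.1 y))
    (fun z => by
      ext e e'
      simp only [g, submatrix_apply, Equiv.coe_fn_mk, marginalYEX_controlState_apply, and_self,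
        if_true])
    (fun z => by
      ext e e'
      simp only [g, submatrix_apply, Equiv.coe_fn_mk, kronecker_apply,
        marginalFst_marginalYEX_controlState_apply hX hρ,
        marginalSnd_marginalYEX_controlState_apply, Matrix.smul_apply, Complex.real_smul,
        Complex.ofReal_mul]
      ring)
    (fun z => (hmean z.1).1) hδ (by linarith) hl0 hM' hdom
  rw [Fintype.sum_prod_type] at hdist htr
  simp only [mul_assoc, ← Finset.mul_sum] at hdist htr
  -- One `l` serves every `x`, with `τ` depending on `x`. Closeness and trace are controlled only on
  -- average over `x`, which is enough as the bound is linear in both.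
  have hcov := fun x => covering_of_approx hY.1 hY.2 (fun y => marginalSnd (ρ x y)) (hmean x).1
    (by rw [(hmean x).2, Complex.one_re]) (fun y => hs (x, y)) hl0 hδ (fun y => hls (x, y)) hK
  refine (Finset.sum_le_sum fun x _ => mul_le_mul_of_nonneg_left (hcov x) (hX.1 x)).trans ?_
  have e : ∑ x, PX x * ((δ * 2 + δ⁻¹ * ((2 : ℝ) ^ l / K * ∑ y, PY y * (s (x, y)).trace.re)) / 2
        + 2 * ∑ y, PY y * traceNorm (marginalSnd (ρ x y) - s (x, y)))
      = (δ * 2 * ∑ x, PX x + δ⁻¹ * ((2 : ℝ) ^ l / K *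
          ∑ x, PX x * ∑ y, PY y * (s (x, y)).trace.re)) / 2
        + 2 * ∑ x, PX x * ∑ y, PY y * traceNorm (marginalSnd (ρ x y) - s (x, y)) := by
    simp only [Finset.mul_sum (s := (Finset.univ : Finset X)), ← Finset.sum_add_distrib,
      Finset.sum_div]
    exact Finset.sum_congr rfl fun x _ => by ring
  rw [e, hX.2]
  have h1 : (2 : ℝ) ^ l / K * ∑ x, PX x * ∑ y, PY y * (s (x, y)).trace.re ≤ δ ^ 2 := by
    have h2 : (2 : ℝ) ^ l / K ≤ δ ^ 2 := by
      rw [div_le_iff₀ hK']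
      linarith
    have h3 : 0 ≤ (2 : ℝ) ^ l / K := by positivity
    nlinarith
  have h4 : δ⁻¹ * ((2 : ℝ) ^ l / K * ∑ x, PX x * ∑ y, PY y * (s (x, y)).trace.re) ≤ δ := by
    rw [inv_mul_le_iff₀ hδ]
    linarith
  linarith

end ControlState

/-! ### Successive cancellation and the conclusion. -/

/-- Telescoping: the error of the joint sample is at most the average error of sampling the second
index for fixed first index, plus the error of sampling the first index. -/
theorem sum_traceNorm_joint_le {X Y S : Type*} [Fintype X] [Fintype Y] [Fintype S] [DecidableEq S]
    {PX : X → ℝ} {PY : Y → ℝ} (hX : PX ∈ stdSimplex ℝ X) (hY : PY ∈ stdSimplex ℝ Y)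
    (r : X → Y → Matrix S S ℂ) (m : X → Matrix S S ℂ) (t : Matrix S S ℂ) {K L : ℕ} (hK : 0 < K) :
    ∑ x : Fin K → X, ∑ y : Fin L → Y, ((∏ i, PX (x i)) * (∏ j, PY (y j))) *
        traceNorm ((1 / ((K : ℝ) * (L : ℝ))) • (∑ i, ∑ j, r (x i) (y j)) - t)
      ≤ ∑ x, PX x * ∑ y : Fin L → Y, (∏ j, PY (y j)) *
          traceNorm ((1 / (L : ℝ)) • ∑ j, r x (y j) - m x)
        + ∑ x : Fin K → X, (∏ i, PX (x i)) * traceNorm ((1 / (K : ℝ)) • ∑ i, m (x i) - t) := by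
  have hK' : (0 : ℝ) < K := by exact_mod_cast hK
  have hpt : ∀ (x : Fin K → X) (y : Fin L → Y),
      traceNorm ((1 / ((K : ℝ) * (L : ℝ))) • (∑ i, ∑ j, r (x i) (y j)) - t)
        ≤ 1 / K * ∑ i, traceNorm ((1 / (L : ℝ)) • ∑ j, r (x i) (y j) - m (x i))
          + traceNorm ((1 / (K : ℝ)) • ∑ i, m (x i) - t) := fun x y => by
    have e : (1 / ((K : ℝ) * (L : ℝ))) • (∑ i, ∑ j, r (x i) (y j)) - t
        = (1 / (K : ℝ)) • ∑ i, ((1 / (L : ℝ)) • ∑ j, r (x i) (y j) - m (x i))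
          + ((1 / (K : ℝ)) • ∑ i, m (x i) - t) := by
      rw [Finset.sum_sub_distrib, smul_sub, ← Finset.smul_sum, smul_smul, one_div_mul_one_div]
      abel
    rw [e]
    refine (traceNorm_add_le _ _).trans (add_le_add ?_ le_rfl)
    rw [traceNorm_smul (by positivity)]
    gcongr
    exact traceNorm_sum_le _ _
  calc _ ≤ ∑ x : Fin K → X, ∑ y : Fin L → Y, ((∏ i, PX (x i)) * (∏ j, PY (y j))) *
        (1 / K * ∑ i, traceNorm ((1 / (L : ℝ)) • ∑ j, r (x i) (y j) - m (x i))
          + traceNorm ((1 / (K : ℝ)) • ∑ i, m (x i) - t)) :=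
        Finset.sum_le_sum fun x _ => Finset.sum_le_sum fun y _ =>
          mul_le_mul_of_nonneg_left (hpt x y) (mul_nonneg
            (Finset.prod_nonneg fun i _ => hX.1 _) (Finset.prod_nonneg fun j _ => hY.1 _))
    _ = 1 / K * ∑ x : Fin K → X, (∏ i, PX (x i)) * ∑ i, ∑ y : Fin L → Y, (∏ j, PY (y j)) *
          traceNorm ((1 / (L : ℝ)) • ∑ j, r (x i) (y j) - m (x i))
        + ∑ x : Fin K → X, (∏ i, PX (x i)) * traceNorm ((1 / (K : ℝ)) • ∑ i, m (x i) - t) := by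
        rw [Finset.mul_sum, ← Finset.sum_add_distrib]
        refine Finset.sum_congr rfl fun x _ => ?_
        simp only [mul_add, Finset.sum_add_distrib]
        congr 1
        · rw [Finset.sum_comm]
          simp only [Finset.mul_sum]
          exact Finset.sum_congr rfl fun _ _ => Finset.sum_congr rfl fun _ _ => by ring
        · rw [← Finset.sum_mul, ← Finset.mul_sum, sum_prod_weight hY.2, mul_one]
    _ = _ := by
        -- All `x i` share the same `y` sample, but by linearity of expectation only the law of a
        -- single `x i` matters.
        have := sum_prod_weight_smul_sum hX.2 (fun x => ∑ y : Fin L → Y, (∏ j, PY (y j)) *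
          traceNorm ((1 / (L : ℝ)) • ∑ j, r x (y j) - m x)) K
        simp only [smul_eq_mul] at this
        rw [this, ← mul_assoc, one_div_mul_cancel hK'.ne', one_mul]

theorem sum_traceNorm_joint_le_two {X Y S : Type*} [Fintype X] [Fintype Y] [Fintype S]
    [DecidableEq S] {PX : X → ℝ} {PY : Y → ℝ} (hX : PX ∈ stdSimplex ℝ X)
    (hY : PY ∈ stdSimplex ℝ Y) {r : X → Y → Matrix S S ℂ} (hr : ∀ x y, IsState (r x y))
    {t : Matrix S S ℂ} (ht : IsState t) {K L : ℕ} (hK : 0 < K) (hL : 0 < L) :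
    ∑ x : Fin K → X, ∑ y : Fin L → Y, ((∏ i, PX (x i)) * (∏ j, PY (y j))) *
        traceNorm ((1 / ((K : ℝ) * (L : ℝ))) • (∑ i, ∑ j, r (x i) (y j)) - t) ≤ 2 := by
  have hK' : (0 : ℝ) < K := by exact_mod_cast hK
  have hL' : (0 : ℝ) < L := by exact_mod_cast hL
  have hpt : ∀ (x : Fin K → X) (y : Fin L → Y),
      traceNorm ((1 / ((K : ℝ) * (L : ℝ))) • (∑ i, ∑ j, r (x i) (y j)) - t) ≤ 2 := fun x y => by
    refine (traceNorm_sub_le _ _).trans ?_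
    rw [traceNorm_smul (by positivity), ht.traceNorm_eq]
    have : traceNorm (∑ i, ∑ j, r (x i) (y j)) ≤ K * L := by
      refine (traceNorm_sum_le _ _).trans ((Finset.sum_le_sum fun i _ =>
        traceNorm_sum_le _ _).trans ?_)
      simp [(hr _ _).traceNorm_eq]
    have h1 : 1 / ((K : ℝ) * L) * traceNorm (∑ i, ∑ j, r (x i) (y j)) ≤ 1 := by
      rw [div_mul_eq_mul_div, one_mul, div_le_one (by positivity)]
      exact this
    linarith
  calc _ ≤ ∑ x : Fin K → X, ∑ y : Fin L → Y, ((∏ i, PX (x i)) * (∏ j, PY (y j))) * 2 :=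
        Finset.sum_le_sum fun x _ => Finset.sum_le_sum fun y _ =>
          mul_le_mul_of_nonneg_left (hpt x y) (mul_nonneg
            (Finset.prod_nonneg fun i _ => hX.1 _) (Finset.prod_nonneg fun j _ => hY.1 _))
    _ = 2 := by
        simp only [← Finset.sum_mul, ← Finset.mul_sum, sum_prod_weight hX.2,
          sum_prod_weight hY.2, mul_one, one_mul]

end CQMAC

theorem mainTheorem2 :
    -- `O1` is the universal constant hidden in `O(1)`.
    ∃ O1 : ℝ,
      ∀ (X Y C E : Type*) [Fintype X] [DecidableEq X] [Fintype Y] [DecidableEq Y]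
        [Fintype C] [Fintype E] [DecidableEq E]
        (PX : X → ℝ) (PY : Y → ℝ) (ρ : X → Y → Matrix (C × E) (C × E) ℂ)
        (δ ε' : ℝ) (K₁ K₂ : ℕ),
        PX ∈ stdSimplex ℝ X → PY ∈ stdSimplex ℝ Y → (∀ x y, CQMAC.IsState (ρ x y)) →
        0 < δ → 0 < ε' → ε' < δ → 0 < K₁ → 0 < K₂ →
        CQMAC.smoothMaxInfo (δ - ε') (CQMAC.marginalXE (CQMAC.controlState PX PY ρ))
            + ((Real.logb 2 (3 / ε' ^ 3) - 1 / 4 * Real.logb 2 δ : ℝ) : EReal)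
          ≤ ((Real.logb 2 K₁ : ℝ) : EReal) →
        CQMAC.smoothMaxInfo (δ - ε') (CQMAC.marginalYEX (CQMAC.controlState PX PY ρ))
            + ((Real.logb 2 (3 / ε' ^ 3) - 1 / 4 * Real.logb 2 δ + O1 : ℝ) : EReal)
          ≤ ((Real.logb 2 K₂ : ℝ) : EReal) →
        ∑ x : Fin K₁ → X, ∑ y : Fin K₂ → Y,
            ((∏ i, PX (x i)) * (∏ j, PY (y j))) *
              CQMAC.traceNorm
                ((1 / ((K₁ : ℝ) * (K₂ : ℝ))) •
                    (∑ i, ∑ j, CQMAC.marginalSnd (ρ (x i) (y j)))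
                  - CQMAC.marginalE (CQMAC.controlState PX PY ρ))
          ≤ 20 * δ ^ (1 / 8 : ℝ) := by
  -- No additive constant is needed: conditioning on `X` costs nothing in the second covering.
  refine ⟨0, ?_⟩
  intro X Y C E _ _ _ _ _ _ _ PX PY ρ δ ε' K₁ K₂ hX hY hρ hδ hε hεδ hK₁ hK₂ h₁ h₂
  rw [CQMAC.marginalE_controlState]
  rcases le_or_gt δ 1 with hδ1 | hδ1
  · rw [add_zero] at h₂
    have hfst := CQMAC.covering_fst hX hY hρ hε hεδ hδ1 hK₁ h₁
    have hsnd := CQMAC.covering_snd hX hY hρ hε hεδ hδ1 hK₂ h₂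
    refine (CQMAC.sum_traceNorm_joint_le hX hY (fun x y => CQMAC.marginalSnd (ρ x y))
      (fun x => ∑ y, PY y • CQMAC.marginalSnd (ρ x y)) _ hK₁).trans ?_
    -- The two errors add up to `16 δ`, within `20 δ ^ (1 / 8)` since `δ ≤ 1`.
    have hpow : δ ≤ δ ^ (1 / 8 : ℝ) := by
      have := Real.rpow_le_rpow_of_exponent_ge hδ hδ1 (show (1 / 8 : ℝ) ≤ 1 by norm_num)
      rwa [Real.rpow_one] at this
    linarith
  · have hpow : 1 ≤ δ ^ (1 / 8 : ℝ) := Real.one_le_rpow hδ1.le (by norm_num)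
    have := CQMAC.sum_traceNorm_joint_le_two hX hY (fun x y => (hρ x y).marginalSnd)
      (CQMAC.isState_sum_smul hX fun x => CQMAC.isState_mean_snd hY hρ x) hK₁ hK₂
    linarith
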